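/- Let $M$ be a quantum system with finite-dimensional Hilbert space $\mathcal H_M=\bigoplus_{k=1}^K\mathcal H_k$ and Hamiltonian $H_M=\bigoplus_{k=1}^K H_k$, where $H_k$ is a Hermitian operator on $\mathcal H_k$, and let $Q_k$ be the orthogonal projection onto $\mathcal H_k$ (so $Q_k^2=Q_k=Q_k^\dagger$ and $\sum_kQ_k=\mathbb 1$). Let $T_M(\sigma)=\sum_kQ_k\sigma Q_k$ be the dephasing map. For an environment $E$ with finite-dimensional Hilbert space, Hermitian Hamiltonian $H_E$ and thermal state $\sigma_E=e^{-\beta H_E}/\operatorname{tr}[e^{-\beta H_E}]$, a unitary $U$ on $\mathcal H_M\otimes\mathcal H_E$ is called a dilation of $T_M$ with $\sigma_E$ if $T_M(\sigma)=\operatorname{tr}_E[U(\sigma\otimes\sigma_E)U^\dagger]$ for all states $\sigma$ on $M$. Its energy cost on the state $\sigma$ is $$E_{\mathrm{deph}}=\operatorname{tr}\big[(H_M\otimes\mathbb 1+\mathbb 1\otimes H_E)\,(U(\sigma\otimes\sigma_E)U^\dagger-\sigma\otimes\sigma_E)\big].$$ (1) For every environment $E$ with Hamiltonian $H_E$, every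 inverse temperature $\beta\ge 0$, every dilation $U$ of $T_M$ with the thermal state $\sigma_E$ of $E$, and every state $\sigma$ on $M$, one has $E_{\mathrm{deph}}\ge 0$. (2) Conversely, for every $\beta\in\mathbb R$ there are an environment of some finite dimension $d\geq 1$, a Hamiltonian $H_E$, and a dilation $U$ of $T_M$ with the corresponding thermal state $\sigma_E$ such that $E_{\mathrm{deph}}=0$ for every state $\sigma$ on $M$. Explicitly: (a) If $E$ has finite dimension $d\ge1$, $H_E=0$, and $V_1,\dots,V_K$ are unitaries on $\mathcal H_E$ with $\operatorname{tr}[V_iV_j^\dagger]=d\,\delta_{ij}$ for all $i,j$, then for every $\beta\in\mathbb R$ the thermal state is $\sigma_E=\mathbb 1/d$, the operator $U=\sum_kQ_k\otimes V_k$ is a dilation of $T_M$ with $\sigma_E$, and $E_{\mathrm{deph}}=0$ for every state $\sigma$ on $M$. (b) The Weyl operators $V_{l,t}=\sum_{r=0}^{d-1}e^{\frac{2\pi i}{d}rt}\,|l+r\rangle\langle r|$ on $\mathbb C^d$, $l,t\in\{0,\dots,d-1\}$ (addition modulo $d$), are unitary and satisfy $\operatorname{tr}[V_{l,t}V_{l',t'}^\dagger]=d\,\delta_{l,l'}\delta_{t,t'}$.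 Hence, whenever $d\geq 1$ and $V_1,\dots,V_K$ are Weyl operators with pairwise distinct indices $(l,t)$, the operator $U=\sum_kQ_k\otimes V_k$ is a dilation of $T_M$ with the thermal state of $H_E=0$ on $\mathbb C^d$, for every $\beta\in\mathbb R$, with $E_{\mathrm{deph}}=0$ for every state $\sigma$ on $M$. -/

import Mathlib

open scoped Matrix Kronecker ComplexOrder

noncomputable section

/-- A family of pairwise orthogonal projections onto subspaces whose direct sum is the whole space:
`Q k ^ 2 = Q k = (Q k)ᴴ` and `∑ k, Q k = 1` (pairwise orthogonality is then automatic). -/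
structure IsProjectiveDecomposition {m κ : Type*} [Fintype m] [DecidableEq m] [Fintype κ]
    (Q : κ → Matrix m m ℂ) : Prop where
  isHermitian : ∀ k, (Q k).IsHermitian
  idempotent : ∀ k, Q k * Q k = Q k
  sum_eq_one : ∑ k, Q k = 1

/-- A Hermitian operator living on the range of the projection `P`, extended by zero. -/
structure IsHamiltonianOn {m : Type*} [Fintype m] (P H : Matrix m m ℂ) : Prop where
  isHermitian : H.IsHermitian
  supported : P * H * P = H

/-- Quantum states: positive semidefinite matrices of trace one. -/
structure IsDensityMatrix {m : Type*} [Fintype m] (ρ : Matrix m m ℂ) : Prop where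
  posSemidef : ρ.PosSemidef
  trace_eq_one : ρ.trace = 1

/-- The dephasing map `σ ↦ ∑ k, Q k σ Q k`. -/
def dephasing {m κ : Type*} [Fintype m] [Fintype κ] (Q : κ → Matrix m m ℂ)
    (σ : Matrix m m ℂ) : Matrix m m ℂ :=
  ∑ k, Q k * σ * Q k

/-- The partial trace over the second tensor factor. -/
def partialTraceEnv {m e : Type*} [Fintype e] (X : Matrix (m × e) (m × e) ℂ) : Matrix m m ℂ :=
  Matrix.of fun i j => ∑ a, X (i, a) (j, a)

/-- The thermal (Gibbs) state `exp (-β H) / tr (exp (-β H))`. -/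
def thermalState {e : Type*} [Fintype e] [DecidableEq e] (β : ℝ) (H : Matrix e e ℂ) :
    Matrix e e ℂ :=
  (NormedSpace.exp (-(β : ℂ) • H)).trace⁻¹ • NormedSpace.exp (-(β : ℂ) • H)

/-- The joint evolution `U (σ ⊗ σE) Uᴴ`. -/
def evolve {m e : Type*} [Fintype m] [Fintype e] (U : Matrix (m × e) (m × e) ℂ)
    (σ : Matrix m m ℂ) (σE : Matrix e e ℂ) : Matrix (m × e) (m × e) ℂ :=
  U * (σ ⊗ₖ σE) * Uᴴ

/-- The unitary `U` and the environment state `σE` dilate the dephasing map: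
`∑ k, Q k σ Q k = tr_E [U (σ ⊗ σE) Uᴴ]` for all states `σ`. -/
structure IsDephasingDilation {m e κ : Type*} [Fintype m] [DecidableEq m] [Fintype e]
    [DecidableEq e] [Fintype κ] (Q : κ → Matrix m m ℂ) (σE : Matrix e e ℂ)
    (U : Matrix (m × e) (m × e) ℂ) : Prop where
  unitary : U ∈ Matrix.unitaryGroup (m × e) ℂ
  dilates : ∀ σ : Matrix m m ℂ, IsDensityMatrix σ →
    dephasing Q σ = partialTraceEnv (evolve U σ σE)

/-- The total Hamiltonian `H_M ⊗ 1 + 1 ⊗ H_E`. -/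
def totalHamiltonian {m e : Type*} [DecidableEq m] [DecidableEq e]
    (HM : Matrix m m ℂ) (HE : Matrix e e ℂ) : Matrix (m × e) (m × e) ℂ :=
  HM ⊗ₖ (1 : Matrix e e ℂ) + (1 : Matrix m m ℂ) ⊗ₖ HE

/-- The energy cost `tr [H_ME (U (σ ⊗ σE) Uᴴ - σ ⊗ σE)]`, as a complex number
(for complex `z`, `0 ≤ z` says that `z` is real and non-negative). -/
def energyCost {m e : Type*} [Fintype m] [DecidableEq m] [Fintype e] [DecidableEq e]
    (HM : Matrix m m ℂ) (HE : Matrix e e ℂ) (U : Matrix (m × e) (m × e) ℂ)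
    (σ : Matrix m m ℂ) (σE : Matrix e e ℂ) : ℂ :=
  (totalHamiltonian HM HE * (evolve U σ σE - σ ⊗ₖ σE)).trace

/-- The Weyl operator `∑ r, exp (2πi r t / d) |l + r⟩⟨r|`, with addition modulo `d`. -/
def weylOperator (d : ℕ) (l t : Fin d) : Matrix (Fin d) (Fin d) ℂ :=
  ∑ r : Fin d, Complex.exp (2 * Real.pi * Complex.I / d * ((r : ℕ) : ℂ) * ((t : ℕ) : ℂ)) •
    Matrix.single (l + r) r (1 : ℂ)

/-- The controlled unitary `∑ k, Q k ⊗ V k`. -/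
def controlledUnitary {m e κ : Type*} [Fintype κ] (Q : κ → Matrix m m ℂ)
    (V : κ → Matrix e e ℂ) : Matrix (m × e) (m × e) ℂ :=
  ∑ k, Q k ⊗ₖ V k

end

/-! Dephasing preserves the mean of the block-diagonal Hamiltonian, so the cost of any dilation is
the energy gained by the environment (`energyCost_eq_environment`).

For the lower bound, a Gibbs state is faithful. A dilation must return a pure state of a block
unchanged, so faithfulness forces every block ⟨a|U|b⟩ to send each vector of that block to a
multiple of itself. Hence it acts there as a scalar, and U = ∑ Q_k ⊗ V_k with V_k unitary
(`IsDephasingDilation.exists_controlledUnitary`). The final environment energy is then the average,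
with weights tr(Q_k σ), of the energies of V_k σ_E V_k†, and passivity (`thermalState_passive`)
bounds each below by the initial energy.

For attainment, H_E = 0 makes the environment maximally mixed and its energy identically zero. Trace
orthogonality of the V_k kills the off-diagonal blocks and keeps the diagonal ones; Weyl operators
supply such families. -/

/-! ### Algebra of the block projections -/

namespace IsProjectiveDecomposition

variable {m κ : Type*} [Fintype m] [DecidableEq m] [Fintype κ] {Q : κ → Matrix m m ℂ}

theorem mul_eq_zero (hQ : IsProjectiveDecomposition Q) {i j : κ} (hij : i ≠ j) :
    Q i * Q j = 0 := by
  classical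
  -- The sum over all k is Q_j (∑ Q_k) Q_j = Q_j, and the term k = j already equals Q_j. The
  -- remaining terms are positive semidefinite, so each vanishes by its trace.
  have key : ∑ k ∈ Finset.univ.erase j, ((Q k * Q j)ᴴ * (Q k * Q j)) = 0 := by
    have h1 : ∑ k, ((Q k * Q j)ᴴ * (Q k * Q j)) = Q j := by
      calc ∑ k, ((Q k * Q j)ᴴ * (Q k * Q j)) = ∑ k, Q j * Q k * Q j := by
            refine Finset.sum_congr rfl fun k _ => ?_
            rw [Matrix.conjTranspose_mul, (hQ.isHermitian j).eq, (hQ.isHermitian k).eq,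
              Matrix.mul_assoc, ← Matrix.mul_assoc (Q k), hQ.idempotent, Matrix.mul_assoc]
        _ = Q j := by
            rw [← Finset.sum_mul, ← Finset.mul_sum, hQ.sum_eq_one, Matrix.mul_one,
              hQ.idempotent]
    rw [← Finset.add_sum_erase _ _ (Finset.mem_univ j), hQ.idempotent, (hQ.isHermitian j).eq,
      hQ.idempotent] at h1
    simpa using h1
  have htr := congrArg Matrix.trace key
  rw [Matrix.trace_sum, Matrix.trace_zero, Finset.sum_eq_zero_iff_of_nonneg fun k _ =>
    (Matrix.posSemidef_conjTranspose_mul_self _).trace_nonneg] at htr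
  exact Matrix.trace_conjTranspose_mul_self_eq_zero_iff.1
    (htr i (Finset.mem_erase.2 ⟨hij, Finset.mem_univ i⟩))

theorem mul_eq_ite [DecidableEq κ] (hQ : IsProjectiveDecomposition Q) (i j : κ) :
    Q i * Q j = if i = j then Q i else 0 := by
  split_ifs with h
  · rw [← h, hQ.idempotent]
  · exact hQ.mul_eq_zero h

theorem mul_sum_hamiltonian (hQ : IsProjectiveDecomposition Q) {H : κ → Matrix m m ℂ}
    (hH : ∀ k, IsHamiltonianOn (Q k) (H k)) (k : κ) : Q k * (∑ j, H j) = H k := by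
  classical
  rw [Finset.mul_sum, Finset.sum_eq_single k]
  · rw [← (hH k).supported, ← Matrix.mul_assoc, ← Matrix.mul_assoc, hQ.idempotent]
  · intro j _ hj
    rw [← (hH j).supported, ← Matrix.mul_assoc, ← Matrix.mul_assoc, hQ.mul_eq_zero hj.symm]
    simp
  · simp

/-- By cyclicity the projections can be moved onto the Hamiltonian, where Q_k H_M Q_k = H_k. -/
theorem trace_hamiltonian_dephasing (hQ : IsProjectiveDecomposition Q) {H : κ → Matrix m m ℂ}
    (hH : ∀ k, IsHamiltonianOn (Q k) (H k)) (σ : Matrix m m ℂ) :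
    ((∑ k, H k) * dephasing Q σ).trace = ((∑ k, H k) * σ).trace := by
  have h (k : κ) : ((∑ j, H j) * (Q k * σ * Q k)).trace = (H k * σ).trace := by
    rw [← Matrix.mul_assoc, Matrix.trace_mul_comm, ← Matrix.mul_assoc, ← Matrix.mul_assoc,
      hQ.mul_sum_hamiltonian hH]
    congr 2
    rw [← (hH k).supported, Matrix.mul_assoc, hQ.idempotent]
  rw [dephasing, Finset.mul_sum, Matrix.trace_sum, Finset.sum_congr rfl fun k _ => h k,
    ← Matrix.trace_sum, ← Finset.sum_mul]

theorem sum_trace_mul (hQ : IsProjectiveDecomposition Q) (σ : Matrix m m ℂ) :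
    ∑ k, (Q k * σ).trace = σ.trace := by
  rw [← Matrix.trace_sum, ← Finset.sum_mul, hQ.sum_eq_one, Matrix.one_mul]

theorem trace_mul_mul (hQ : IsProjectiveDecomposition Q) [DecidableEq κ] (σ : Matrix m m ℂ)
    (i j : κ) :
    (Q i * σ * Q j).trace = if i = j then (Q i * σ).trace else 0 := by
  rw [Matrix.trace_mul_comm, ← Matrix.mul_assoc, hQ.mul_eq_ite]
  by_cases h : i = j
  · simp [h]
  · simp [h, Ne.symm h]

theorem trace_mul_nonneg (hQ : IsProjectiveDecomposition Q) {σ : Matrix m m ℂ}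
    (hσ : σ.PosSemidef) (k : κ) : 0 ≤ (Q k * σ).trace := by
  have h := (hσ.mul_mul_conjTranspose_same (Q k)).trace_nonneg
  rwa [Matrix.trace_mul_comm, (hQ.isHermitian k).eq, ← Matrix.mul_assoc, hQ.idempotent] at h

end IsProjectiveDecomposition

theorem thermalState_zero {e : Type*} [Fintype e] [DecidableEq e] (β : ℝ) :
    thermalState β (0 : Matrix e e ℂ) = (Fintype.card e : ℂ)⁻¹ • 1 := by
  simp [thermalState, NormedSpace.exp_zero]

/-! ### Partial traces and controlled unitaries -/

section PartialTrace

variable {m e κ : Type*} [Fintype e]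

theorem partialTraceEnv_kronecker (A : Matrix m m ℂ) (B : Matrix e e ℂ) :
    partialTraceEnv (A ⊗ₖ B) = B.trace • A := by
  ext i j
  simp [partialTraceEnv, Matrix.trace, ← Finset.mul_sum, mul_comm]

theorem partialTraceEnv_sum {ι : Type*} (s : Finset ι) (X : ι → Matrix (m × e) (m × e) ℂ) :
    partialTraceEnv (∑ i ∈ s, X i) = ∑ i ∈ s, partialTraceEnv (X i) := by
  ext i j
  simp only [partialTraceEnv, Matrix.of_apply, Matrix.sum_apply]
  exact Finset.sum_comm

variable [Fintype m]

theorem trace_kronecker_one_mul [DecidableEq e] (A : Matrix m m ℂ)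
    (X : Matrix (m × e) (m × e) ℂ) :
    ((A ⊗ₖ (1 : Matrix e e ℂ)) * X).trace = (A * partialTraceEnv X).trace := by
  simp only [Matrix.trace, Matrix.diag, Matrix.mul_apply, partialTraceEnv, Matrix.of_apply,
    Fintype.sum_prod_type, Matrix.kroneckerMap_apply, Matrix.one_apply, mul_ite, mul_one,
    mul_zero, ite_mul, zero_mul, Finset.sum_ite_eq, Finset.mem_univ, if_true, Finset.mul_sum]
  exact Finset.sum_congr rfl fun i _ => Finset.sum_comm

variable [Fintype κ]

theorem evolve_controlledUnitary {Q : κ → Matrix m m ℂ} (hQ : ∀ k, (Q k).IsHermitian)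
    (V : κ → Matrix e e ℂ) (σ : Matrix m m ℂ) (σE : Matrix e e ℂ) :
    evolve (controlledUnitary Q V) σ σE =
      ∑ i, ∑ j, (Q i * σ * Q j) ⊗ₖ (V i * σE * (V j)ᴴ) := by
  rw [evolve, controlledUnitary, Matrix.conjTranspose_sum, Finset.sum_mul, Finset.sum_mul]
  refine Finset.sum_congr rfl fun i _ => ?_
  rw [Finset.mul_sum]
  refine Finset.sum_congr rfl fun j _ => ?_
  rw [Matrix.conjTranspose_kronecker, (hQ j).eq, ← Matrix.mul_kronecker_mul,
    ← Matrix.mul_kronecker_mul]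

variable [DecidableEq m]

/-- Tracing out the system removes the cross terms, since Q_j Q_i = 0 for i ≠ j. -/
theorem environmentEnergy_controlledUnitary {Q : κ → Matrix m m ℂ}
    (hQ : IsProjectiveDecomposition Q) (V : κ → Matrix e e ℂ) (HE : Matrix e e ℂ)
    (σ : Matrix m m ℂ) (σE : Matrix e e ℂ) :
    (((1 : Matrix m m ℂ) ⊗ₖ HE) * evolve (controlledUnitary Q V) σ σE).trace =
      ∑ k, (Q k * σ).trace * (HE * (V k * σE * (V k)ᴴ)).trace := by
  classical
  simp only [evolve_controlledUnitary hQ.isHermitian, Finset.mul_sum, Matrix.trace_sum,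
    ← Matrix.mul_kronecker_mul, Matrix.trace_kronecker, Matrix.one_mul, hQ.trace_mul_mul,
    ite_mul, zero_mul, Finset.sum_ite_eq, Finset.mem_univ, if_true]

variable [DecidableEq e]

theorem controlledUnitary_mem {Q : κ → Matrix m m ℂ} (hQ : IsProjectiveDecomposition Q)
    {V : κ → Matrix e e ℂ} (hV : ∀ k, V k ∈ Matrix.unitaryGroup e ℂ) :
    controlledUnitary Q V ∈ Matrix.unitaryGroup (m × e) ℂ := by
  classical
  rw [Matrix.mem_unitaryGroup_iff, Matrix.star_eq_conjTranspose]
  -- Evolving the identity produces U U†.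
  have h := evolve_controlledUnitary hQ.isHermitian V 1 1
  rw [evolve, Matrix.one_kronecker_one, Matrix.mul_one] at h
  rw [h]
  simp only [Matrix.mul_one, hQ.mul_eq_ite]
  have (i : κ) : ∑ j, (if i = j then Q i else 0) ⊗ₖ (V i * (V j)ᴴ) =
      Q i ⊗ₖ (1 : Matrix e e ℂ) := by
    rw [Finset.sum_eq_single i]
    · rw [if_pos rfl, ← Matrix.star_eq_conjTranspose, Matrix.mem_unitaryGroup_iff.1 (hV i)]
    · intro j _ hj
      rw [if_neg hj.symm, Matrix.zero_kronecker]
    · simp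
  rw [Finset.sum_congr rfl fun i _ => this i]
  ext ⟨a, b⟩ ⟨c, d⟩
  simp only [Matrix.sum_apply, Matrix.kroneckerMap_apply, ← Finset.sum_mul]
  rw [← Matrix.sum_apply, hQ.sum_eq_one]
  exact congrFun₂ (Matrix.one_kronecker_one (α := ℂ)) (a, b) (c, d)

theorem energyCost_eq_environment {Q : κ → Matrix m m ℂ} (hQ : IsProjectiveDecomposition Q)
    {H : κ → Matrix m m ℂ} (hH : ∀ k, IsHamiltonianOn (Q k) (H k)) (HE : Matrix e e ℂ)
    {U : Matrix (m × e) (m × e) ℂ} {σ : Matrix m m ℂ} {σE : Matrix e e ℂ}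
    (hσE : σE.trace = 1) (hU : IsDephasingDilation Q σE U) (hσ : IsDensityMatrix σ) :
    energyCost (∑ k, H k) HE U σ σE =
      (((1 : Matrix m m ℂ) ⊗ₖ HE) * evolve U σ σE).trace - (HE * σE).trace := by
  rw [energyCost, totalHamiltonian, Matrix.add_mul, Matrix.trace_add, Matrix.mul_sub,
    Matrix.trace_sub, trace_kronecker_one_mul, ← hU.dilates σ hσ,
    hQ.trace_hamiltonian_dephasing hH, trace_kronecker_one_mul, partialTraceEnv_kronecker, hσE,
    one_smul, sub_self, zero_add, Matrix.mul_sub, Matrix.trace_sub, ← Matrix.mul_kronecker_mul,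
    Matrix.trace_kronecker, Matrix.one_mul, hσ.trace_eq_one, one_mul]

/-- With a maximally mixed environment, block (i, j) of the output carries the factor tr(V_i
V_j†)/d. -/
theorem isDephasingDilation_of_trace_orthogonal [DecidableEq κ] [Nonempty e]
    {Q : κ → Matrix m m ℂ} (hQ : IsProjectiveDecomposition Q) {V : κ → Matrix e e ℂ}
    (hV : ∀ k, V k ∈ Matrix.unitaryGroup e ℂ)
    (hVV : ∀ i j, (V i * (V j)ᴴ).trace = if i = j then (Fintype.card e : ℂ) else 0) (β : ℝ) :
    IsDephasingDilation Q (thermalState β (0 : Matrix e e ℂ)) (controlledUnitary Q V) where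
  unitary := controlledUnitary_mem hQ hV
  dilates σ _ := by
    have hc : (Fintype.card e : ℂ) ≠ 0 := Nat.cast_ne_zero.2 Fintype.card_ne_zero
    simp only [evolve_controlledUnitary hQ.isHermitian, thermalState_zero, partialTraceEnv_sum,
      partialTraceEnv_kronecker, Matrix.mul_smul, Matrix.mul_one, Matrix.smul_mul,
      Matrix.trace_smul, hVV, smul_eq_mul, mul_ite, mul_zero, inv_mul_cancel₀ hc, ite_smul,
      one_smul, zero_smul, Finset.sum_ite_eq, Finset.mem_univ, if_true, dephasing]

theorem energyCost_zero_hamiltonian [Nonempty e] {Q : κ → Matrix m m ℂ}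
    (hQ : IsProjectiveDecomposition Q) {H : κ → Matrix m m ℂ}
    (hH : ∀ k, IsHamiltonianOn (Q k) (H k)) {β : ℝ} {U : Matrix (m × e) (m × e) ℂ}
    (hU : IsDephasingDilation Q (thermalState β (0 : Matrix e e ℂ)) U) {σ : Matrix m m ℂ}
    (hσ : IsDensityMatrix σ) :
    energyCost (∑ k, H k) 0 U σ (thermalState β (0 : Matrix e e ℂ)) = 0 := by
  rw [energyCost_eq_environment hQ hH 0 (by simp [thermalState_zero]) hU hσ]
  simp

end PartialTrace

/-! ### Weyl operators -/

theorem weylOperator_apply (d : ℕ) (l t i j : Fin d) :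
    weylOperator d l t i j = if l + j = i then
      Complex.exp (2 * Real.pi * Complex.I / d * ((j : ℕ) : ℂ) * ((t : ℕ) : ℂ)) else 0 := by
  simp only [weylOperator, Matrix.sum_apply, Matrix.smul_apply, Matrix.single_apply, smul_eq_mul,
    mul_ite, mul_one, mul_zero]
  rw [Finset.sum_eq_single j]
  · simp
  · intro b _ hb
    simp [hb]
  · simp

theorem exp_mul_star_exp (d : ℕ) (j t t' : ℕ) :
    Complex.exp (2 * Real.pi * Complex.I / d * (j : ℂ) * (t : ℂ)) *
      star (Complex.exp (2 * Real.pi * Complex.I / d * (j : ℂ) * (t' : ℂ))) =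
    Complex.exp (2 * Real.pi * Complex.I * (((t : ℤ) - (t' : ℤ) : ℤ) / d)) ^ j := by
  rw [Complex.star_def, ← Complex.exp_conj, ← Complex.exp_add, ← Complex.exp_nat_mul]
  congr 1
  simp only [map_mul, map_div₀, Complex.conj_ofReal, Complex.conj_I, map_natCast, map_ofNat]
  push_cast
  ring

theorem weylOperator_mem_unitaryGroup (d : ℕ) (l t : Fin d) :
    weylOperator d l t ∈ Matrix.unitaryGroup (Fin d) ℂ := by
  have : NeZero d := ⟨(Fin.pos l).ne'⟩
  rw [Matrix.mem_unitaryGroup_iff']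
  ext i j
  simp only [Matrix.mul_apply, Matrix.star_apply, weylOperator_apply, Matrix.one_apply, mul_ite,
    mul_zero, Finset.sum_ite_eq, Finset.mem_univ, if_true]
  by_cases h : i = j
  · subst h
    rw [if_pos rfl, if_pos rfl, mul_comm, exp_mul_star_exp]
    simp
  · rw [if_neg h, if_neg (fun h' => h (add_left_cancel h'))]
    simp

/-- A geometric sum over a d-th root of unity, which is not 1 because 0 < |t - t'| < d. -/
theorem sum_exp_pow_eq_zero {d : ℕ} {t t' : Fin d} (h : t ≠ t') :
    ∑ r : Fin d, Complex.exp (2 * Real.pi * Complex.I *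
      ((((t : ℕ) : ℤ) - ((t' : ℕ) : ℤ) : ℤ) / d)) ^ (r : ℕ) = 0 := by
  have hd : (d : ℂ) ≠ 0 := Nat.cast_ne_zero.2 (Fin.pos t).ne'
  rw [Fin.sum_univ_eq_sum_range (fun r => Complex.exp (2 * Real.pi * Complex.I *
      ((((t : ℕ) : ℤ) - ((t' : ℕ) : ℤ) : ℤ) / d)) ^ r) d, geom_sum_eq, ← Complex.exp_nat_mul]
  · have : (d : ℂ) * (2 * Real.pi * Complex.I *
        ((((t : ℕ) : ℤ) - ((t' : ℕ) : ℤ) : ℤ) / d)) =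
        (((t : ℕ) : ℤ) - ((t' : ℕ) : ℤ) : ℤ) * (2 * Real.pi * Complex.I) := by
      field_simp
    rw [this, Complex.exp_int_mul_two_pi_mul_I]
    simp
  · rw [Ne, Complex.exp_eq_one_iff]
    rintro ⟨n, hn⟩
    rw [mul_comm (n : ℂ)] at hn
    have h2 := mul_left_cancel₀ Complex.two_pi_I_ne_zero hn
    rw [div_eq_iff hd] at h2
    have h3 : ((t : ℕ) : ℤ) - ((t' : ℕ) : ℤ) = n * d := by exact_mod_cast h2
    have h4 : |((t : ℕ) : ℤ) - ((t' : ℕ) : ℤ)| < d := by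
      rw [abs_lt]
      constructor <;> omega
    have h5 := Int.eq_zero_of_abs_lt_dvd ⟨n, h3.trans (mul_comm _ _)⟩ h4
    exact h (Fin.ext (by omega))

theorem trace_weylOperator_mul (d : ℕ) (l t l' t' : Fin d) :
    (weylOperator d l t * (weylOperator d l' t')ᴴ).trace =
      if l = l' ∧ t = t' then (d : ℂ) else 0 := by
  have : NeZero d := ⟨(Fin.pos l).ne'⟩
  -- In this order each diagonal entry involves column r of both operators, and each such column has
  -- a single nonzero entry.
  rw [Matrix.trace_mul_comm]
  have key (r : Fin d) : ((weylOperator d l' t')ᴴ * weylOperator d l t) r r =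
      if l = l' then Complex.exp (2 * Real.pi * Complex.I *
      ((((t : ℕ) : ℤ) - ((t' : ℕ) : ℤ) : ℤ) / d)) ^ (r : ℕ) else 0 := by
    simp only [Matrix.mul_apply, Matrix.conjTranspose_apply, weylOperator_apply, mul_ite,
      mul_zero, Finset.sum_ite_eq, Finset.mem_univ, if_true]
    by_cases h : l = l'
    · rw [if_pos h, if_pos (by rw [h]), mul_comm, exp_mul_star_exp]
    · rw [if_neg h, if_neg (fun h' => h (add_right_cancel h').symm), star_zero, zero_mul]
  simp only [Matrix.trace, Matrix.diag_apply, key]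
  by_cases hl : l = l'
  · by_cases ht : t = t'
    · simp [hl, ht]
    · simp only [hl, ht, if_true, and_false, if_false]
      exact sum_exp_pow_eq_zero ht
  · simp [hl]

/-! ### Gibbs states and passivity -/

section ThermalState

variable {e : Type*} [Fintype e]

/-- A doubly stochastic mixing of Gibbs weights does not lower the mean energy. -/
theorem sum_gibbs_le {β : ℝ} (hβ : 0 ≤ β) (E : e → ℝ) {D : e → e → ℝ}
    (hD : ∀ i j, 0 ≤ D i j) (hrow : ∀ i, ∑ j, D i j = 1) (hcol : ∀ j, ∑ i, D i j = 1) :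
    ∑ i, E i * Real.exp (-β * E i) ≤ ∑ i, ∑ j, E i * Real.exp (-β * E j) * D i j := by
  -- The argument ends by dividing by β; at β = 0 both sides are ∑ E_i.
  rcases hβ.eq_or_lt with rfl | hβ
  · simp [← Finset.mul_sum, hrow]
  -- This is exp x ≥ 1 + x at x = β(E_j - E_i), times exp(-βE_j) D_ij. Summed over i and j, the left
  -- side cancels by double stochasticity.
  have hpt (i j : e) : (Real.exp (-β * E j) - Real.exp (-β * E i)) * D i j ≤
      β * (E i * Real.exp (-β * E j) * D i j - E j * Real.exp (-β * E j) * D i j) := by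
    have h1 := mul_le_mul_of_nonneg_left (Real.add_one_le_exp (-β * E i - -β * E j))
      (Real.exp_pos (-β * E j)).le
    rw [← Real.exp_add, add_sub_cancel] at h1
    nlinarith [mul_le_mul_of_nonneg_right h1 (hD i j)]
  have hR (f : e → ℝ) : ∑ i, ∑ j, f i * D i j = ∑ i, f i := by
    simp only [← Finset.mul_sum, hrow, mul_one]
  have hC (f : e → ℝ) : ∑ i, ∑ j, f j * D i j = ∑ i, f i := by
    rw [Finset.sum_comm]
    simp only [← Finset.mul_sum, hcol, mul_one]
  have hsum := Finset.sum_le_sum fun i (_ : i ∈ Finset.univ) =>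
    Finset.sum_le_sum fun j (_ : j ∈ Finset.univ) => hpt i j
  simp only [sub_mul, Finset.sum_sub_distrib, ← Finset.mul_sum (a := β)] at hsum
  rw [hC fun i => Real.exp (-β * E i), hR fun i => Real.exp (-β * E i),
    hC fun i => E i * Real.exp (-β * E i), sub_self] at hsum
  exact sub_nonneg.1 (nonneg_of_mul_nonneg_right hsum hβ)

variable [DecidableEq e]

/-- A Gibbs state is diagonal in an eigenbasis of its Hamiltonian. -/
theorem exists_thermalState_eq [Nonempty e] {HE : Matrix e e ℂ} (hHE : HE.IsHermitian) (β : ℝ) :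
    ∃ (W : Matrix e e ℂ) (E : e → ℝ) (Z : ℝ), W ∈ Matrix.unitaryGroup e ℂ ∧ 0 < Z ∧
      Z = ∑ i, Real.exp (-β * E i) ∧ HE = W * Matrix.diagonal (fun i => (E i : ℂ)) * Wᴴ ∧
      thermalState β HE =
        W * Matrix.diagonal (fun i => ((Real.exp (-β * E i) / Z : ℝ) : ℂ)) * Wᴴ := by
  set W : Matrix e e ℂ := hHE.eigenvectorUnitary.1 with hW
  have hWm : W ∈ Matrix.unitaryGroup e ℂ := hHE.eigenvectorUnitary.2
  have hWW : W * Wᴴ = 1 := Matrix.mem_unitaryGroup_iff.1 hWm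
  have hWW' : Wᴴ * W = 1 := Matrix.mem_unitaryGroup_iff'.1 hWm
  have hspec : HE = W * Matrix.diagonal (fun i => (hHE.eigenvalues i : ℂ)) * Wᴴ := by
    conv_lhs => rw [hHE.spectral_theorem, Unitary.conjStarAlgAut_apply]
    rfl
  have hexp : NormedSpace.exp (-(β : ℂ) • HE) =
      W * Matrix.diagonal (fun i => ((Real.exp (-β * hHE.eigenvalues i) : ℝ) : ℂ)) * Wᴴ := by
    have hinv : W⁻¹ = Wᴴ := Matrix.inv_eq_right_inv hWW
    have : -(β : ℂ) • HE =
        W * Matrix.diagonal (fun i => -(β : ℂ) * (hHE.eigenvalues i : ℂ)) * W⁻¹ := by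
      conv_lhs => rw [hspec]
      rw [hinv, ← Matrix.smul_mul, ← Matrix.mul_smul, ← Matrix.diagonal_smul]
      rfl
    rw [this, Matrix.exp_conj _ _ (IsUnit.of_mul_eq_one _ hWW), hinv, Matrix.exp_diagonal]
    congr 3
    ext i
    rw [Pi.coe_exp, ← Complex.exp_eq_exp_ℂ]
    push_cast
    rfl
  refine ⟨W, hHE.eigenvalues, ∑ i, Real.exp (-β * hHE.eigenvalues i), hWm,
    Finset.sum_pos (fun i _ => Real.exp_pos _) Finset.univ_nonempty, rfl, hspec, ?_⟩
  have htr : (NormedSpace.exp (-(β : ℂ) • HE)).trace =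
      ((∑ i, Real.exp (-β * hHE.eigenvalues i) : ℝ) : ℂ) := by
    rw [hexp, Matrix.trace_mul_comm, ← Matrix.mul_assoc, hWW', Matrix.one_mul,
      Matrix.trace_diagonal]
    push_cast
    rfl
  rw [thermalState, htr, hexp, ← Matrix.smul_mul, ← Matrix.mul_smul, ← Matrix.diagonal_smul]
  congr 3
  ext i
  simp only [Pi.smul_apply, smul_eq_mul]
  push_cast
  ring

theorem thermalState_trace [Nonempty e] {HE : Matrix e e ℂ} (hHE : HE.IsHermitian) (β : ℝ) :
    (thermalState β HE).trace = 1 := by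
  obtain ⟨W, E, Z, hW, hZ, hZE, -, h⟩ := exists_thermalState_eq hHE β
  rw [h, Matrix.trace_mul_comm, ← Matrix.mul_assoc, ← Matrix.star_eq_conjTranspose,
    Matrix.mem_unitaryGroup_iff'.1 hW, Matrix.one_mul, Matrix.trace_diagonal,
    ← Complex.ofReal_sum, ← Finset.sum_div, ← hZE, div_self hZ.ne', Complex.ofReal_one]

/-- Gibbs weights are strictly positive; this faithfulness drives the structure theorem for
dilations. -/
theorem thermalState_posDef [Nonempty e] {HE : Matrix e e ℂ} (hHE : HE.IsHermitian) (β : ℝ) :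
    (thermalState β HE).PosDef := by
  obtain ⟨W, E, Z, hW, hZ, -, -, h⟩ := exists_thermalState_eq hHE β
  rw [h, ← Matrix.star_eq_conjTranspose, Matrix.IsUnit.posDef_star_right_conjugate_iff
    (IsUnit.of_mul_eq_one _ (Matrix.mem_unitaryGroup_iff.1 hW)), Matrix.posDef_diagonal_iff]
  intro i
  exact_mod_cast div_pos (Real.exp_pos _) hZ

theorem trace_diagonal_mul_conj_diagonal (a b : e → ℝ) (T : Matrix e e ℂ) :
    (Matrix.diagonal (fun i => (a i : ℂ)) *
      (T * Matrix.diagonal (fun i => (b i : ℂ)) * Tᴴ)).trace =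
      ((∑ i, ∑ j, a i * b j * Complex.normSq (T i j) : ℝ) : ℂ) := by
  push_cast
  refine Finset.sum_congr rfl fun i _ => ?_
  rw [Matrix.diag_apply, Matrix.diagonal_mul, Matrix.mul_apply, Finset.mul_sum]
  refine Finset.sum_congr rfl fun j _ => ?_
  rw [Matrix.mul_diagonal, Matrix.conjTranspose_apply, Complex.normSq_eq_conj_mul_self, Complex.star_def]
  ring

theorem sum_normSq_row {T : Matrix e e ℂ} (hT : T ∈ Matrix.unitaryGroup e ℂ) (i : e) :
    ∑ j, Complex.normSq (T i j) = 1 := by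
  have h := congrFun₂ (Matrix.mem_unitaryGroup_iff.1 hT) i i
  simp only [Matrix.mul_apply, Matrix.star_apply, Matrix.one_apply_eq, Complex.star_def,
    Complex.mul_conj] at h
  exact_mod_cast h

theorem sum_normSq_col {T : Matrix e e ℂ} (hT : T ∈ Matrix.unitaryGroup e ℂ) (j : e) :
    ∑ i, Complex.normSq (T i j) = 1 := by
  have h := congrFun₂ (Matrix.mem_unitaryGroup_iff'.1 hT) j j
  simp only [Matrix.mul_apply, Matrix.star_apply, Matrix.one_apply_eq, Complex.star_def,
    mul_comm (starRingEnd ℂ _), Complex.mul_conj] at h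
  exact_mod_cast h

/-- Passivity of Gibbs states. -/
theorem thermalState_passive {HE : Matrix e e ℂ} (hHE : HE.IsHermitian) {β : ℝ} (hβ : 0 ≤ β)
    {V : Matrix e e ℂ} (hV : V ∈ Matrix.unitaryGroup e ℂ) :
    (HE * thermalState β HE).trace ≤ (HE * (V * thermalState β HE * Vᴴ)).trace := by
  cases isEmpty_or_nonempty e
  · simp [Matrix.trace]
  obtain ⟨W, E, Z, hW, hZ, -, hHW, h⟩ := exists_thermalState_eq hHE β
  have hWW' : Wᴴ * W = 1 := Matrix.mem_unitaryGroup_iff'.1 hW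
  set p : e → ℝ := fun i => Real.exp (-β * E i) / Z with hp
  have key {X : Matrix e e ℂ} : (HE * (X * thermalState β HE * Xᴴ)).trace =
      ((∑ i, ∑ j, E i * p j * Complex.normSq ((Wᴴ * X * W) i j) : ℝ) : ℂ) := by
    rw [← trace_diagonal_mul_conj_diagonal, h, hHW, Matrix.mul_assoc, Matrix.mul_assoc,
      Matrix.trace_mul_comm]
    simp only [Matrix.conjTranspose_mul, Matrix.conjTranspose_conjTranspose, Matrix.mul_assoc, hp]
  -- Taking X = 1 recovers the initial energy; X = V gives the doubly stochastic matrix of the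
  -- |T_ij|² with T = W†VW.
  have h1 := key (X := 1)
  rw [Matrix.one_mul, Matrix.conjTranspose_one, Matrix.mul_one, Matrix.mul_one, hWW'] at h1
  rw [h1, key, Complex.real_le_real]
  have hT : Wᴴ * V * W ∈ Matrix.unitaryGroup e ℂ :=
    mul_mem (mul_mem (Unitary.star_mem hW) hV) hW
  have hmain := sum_gibbs_le hβ E (fun i j => Complex.normSq_nonneg ((Wᴴ * V * W) i j))
    (sum_normSq_row hT) (sum_normSq_col hT)
  have hdiv := div_le_div_of_nonneg_right hmain hZ.le
  simp only [Finset.sum_div] at hdiv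
  calc _ = ∑ i, E i * Real.exp (-β * E i) / Z := by
        refine Finset.sum_congr rfl fun i _ => ?_
        rw [Finset.sum_eq_single i]
        · simp [hp, mul_div_assoc]
        · intro j _ hj
          simp [Matrix.one_apply_ne hj.symm]
        · simp
    _ ≤ _ := hdiv
    _ = _ := by
        refine Finset.sum_congr rfl fun i _ => Finset.sum_congr rfl fun j _ => ?_
        rw [hp]
        ring

end ThermalState

/-! ### Structure of dilations with a faithful environment -/

section Structure

variable {m e κ : Type*}

/-- The operator `⟨a| U |b⟩` on the first tensor factor. -/
def envBlock (U : Matrix (m × e) (m × e) ℂ) (a b : e) : Matrix m m ℂ :=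
  Matrix.of fun i j => U (i, a) (j, b)

variable [Fintype m] [Fintype e]

/-- Writes an output expectation as a sum of quadratic forms of σ_E in the amplitudes ⟨φ, a|U|ψ, b⟩,
so that a zero expectation forces all amplitudes to vanish when σ_E is faithful. -/
theorem partialTraceEnv_evolve_apply (U : Matrix (m × e) (m × e) ℂ) (ψ φ : m → ℂ)
    (σE : Matrix e e ℂ) :
    star φ ⬝ᵥ (partialTraceEnv (evolve U (Matrix.vecMulVec ψ (star ψ)) σE) *ᵥ φ) =
      ∑ a, (fun b => star φ ⬝ᵥ (envBlock U a b *ᵥ ψ)) ⬝ᵥ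
        (σE *ᵥ star (fun b => star φ ⬝ᵥ (envBlock U a b *ᵥ ψ))) := by
  set W : e → Matrix m e ℂ := fun a => Matrix.of fun n b => (envBlock U a b *ᵥ ψ) n with hW
  have h1 : partialTraceEnv (evolve U (Matrix.vecMulVec ψ (star ψ)) σE) =
      ∑ a, W a * σE * (W a)ᴴ := by
    ext n n'
    simp only [partialTraceEnv, evolve, Matrix.of_apply, Matrix.sum_apply]
    refine Finset.sum_congr rfl fun a _ => ?_
    simp only [Matrix.mul_apply, Fintype.sum_prod_type, Matrix.kroneckerMap_apply,
      Matrix.vecMulVec_apply, Matrix.conjTranspose_apply, hW, Matrix.of_apply, envBlock,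
      Matrix.mulVec, dotProduct, Pi.star_apply]
    rw [Finset.sum_comm]
    refine Finset.sum_congr rfl fun c _ => ?_
    rw [star_sum, Finset.mul_sum (s := Finset.univ)]
    refine Finset.sum_congr rfl fun l _ => ?_
    rw [Finset.sum_comm, star_mul, ← mul_assoc]
    congr 1
    rw [Finset.sum_mul]
    refine Finset.sum_congr rfl fun b _ => ?_
    rw [Finset.sum_mul, Finset.sum_mul]
    exact Finset.sum_congr rfl fun k _ => by ring
  have h2 (a : e) : (fun b => star φ ⬝ᵥ (envBlock U a b *ᵥ ψ)) = star φ ᵥ* W a := rfl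
  rw [h1, Matrix.sum_mulVec, dotProduct_sum]
  refine Finset.sum_congr rfl fun a _ => ?_
  rw [h2, Matrix.star_vecMul, star_star, Matrix.dotProduct_mulVec, Matrix.dotProduct_mulVec,
    Matrix.dotProduct_mulVec, Matrix.vecMul_vecMul, Matrix.vecMul_vecMul,
    Matrix.mul_assoc]

theorem eq_zero_of_sum_dotProduct {σE : Matrix e e ℂ} (hσE : σE.PosDef) {Z : e → e → ℂ}
    (h : ∑ a, Z a ⬝ᵥ (σE *ᵥ star (Z a)) = 0) (a b : e) : Z a b = 0 := by
  have hz (a : e) : Z a ⬝ᵥ (σE *ᵥ star (Z a)) = 0 := by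
    refine (Finset.sum_eq_zero_iff_of_nonneg fun a _ => ?_).1 h a (Finset.mem_univ a)
    simpa using hσE.posSemidef.dotProduct_mulVec_nonneg (star (Z a))
  by_contra hab
  have hne : star (Z a) ≠ 0 := fun h0 => hab (by simpa using congrFun h0 b)
  have := hσE.dotProduct_mulVec_pos hne
  rw [star_star, hz] at this
  exact lt_irrefl _ this

theorem isDensityMatrix_vecMulVec {ψ : m → ℂ} (hψ : star ψ ⬝ᵥ ψ = 1) :
    IsDensityMatrix (Matrix.vecMulVec ψ (star ψ)) :=
  ⟨Matrix.posSemidef_vecMulVec_self_star ψ, by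
    rw [Matrix.trace_vecMulVec, dotProduct_comm, hψ]⟩

variable [Fintype κ] [DecidableEq m] [DecidableEq e]

theorem dephasing_vecMulVec {Q : κ → Matrix m m ℂ} (hQ : IsProjectiveDecomposition Q) {k : κ}
    {ψ : m → ℂ} (hψ : Q k *ᵥ ψ = ψ) :
    dephasing Q (Matrix.vecMulVec ψ (star ψ)) = Matrix.vecMulVec ψ (star ψ) := by
  have hne {j : κ} (hj : j ≠ k) : Q j *ᵥ ψ = 0 := by
    rw [← hψ, Matrix.mulVec_mulVec, hQ.mul_eq_zero hj, Matrix.zero_mulVec]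
  rw [dephasing, Finset.sum_eq_single k]
  · rw [Matrix.mul_vecMulVec, Matrix.vecMulVec_mul, hψ]
    nth_rw 1 [← (hQ.isHermitian k).eq]
    rw [← Matrix.star_mulVec, hψ]
  · intro j _ hj
    rw [Matrix.mul_vecMulVec, hne hj, Matrix.zero_vecMulVec, Matrix.zero_mul]
  · simp

/-- A dilation of the dephasing map maps every state vector of a block to a multiple of itself. -/
theorem IsDephasingDilation.exists_eigenvalue {Q : κ → Matrix m m ℂ}
    (hQ : IsProjectiveDecomposition Q) {σE : Matrix e e ℂ} (hσE : σE.PosDef)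
    {U : Matrix (m × e) (m × e) ℂ} (hU : IsDephasingDilation Q σE U) {k : κ} {ψ : m → ℂ}
    (hψ : Q k *ᵥ ψ = ψ) (a b : e) : ∃ c : ℂ, envBlock U a b *ᵥ ψ = c • ψ := by
  by_cases h0 : ψ = 0
  · exact ⟨0, by simp [h0]⟩
  -- Normalization is needed because the dilation property covers only density matrices.
  wlog h1 : star ψ ⬝ᵥ ψ = 1 generalizing ψ
  · have hpos : 0 < star ψ ⬝ᵥ ψ := Matrix.dotProduct_star_self_pos_iff.2 h0
    obtain ⟨r, hr, hrr⟩ : ∃ r : ℝ, 0 < r ∧ star ψ ⬝ᵥ ψ = r :=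
      ⟨(star ψ ⬝ᵥ ψ).re, (Complex.pos_iff.1 hpos).1,
        Complex.ext rfl (by simpa using (Complex.pos_iff.1 hpos).2.symm)⟩
    have hs : ((Real.sqrt r : ℝ) : ℂ) ≠ 0 := by
      exact_mod_cast (Real.sqrt_pos.2 hr).ne'
    obtain ⟨c, hc⟩ := this (ψ := ((Real.sqrt r : ℝ) : ℂ)⁻¹ • ψ)
      (by rw [Matrix.mulVec_smul, hψ]) (smul_ne_zero (inv_ne_zero hs) h0) (by
        rw [star_smul, smul_dotProduct, dotProduct_smul, hrr]
        simp only [smul_eq_mul, star_inv₀, Complex.star_def, Complex.conj_ofReal]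
        field_simp
        rw [← Complex.ofReal_pow, Real.sq_sqrt hr.le])
    refine ⟨c, ?_⟩
    rw [Matrix.mulVec_smul, smul_comm] at hc
    exact smul_right_injective _ (inv_ne_zero hs) hc
  refine ⟨star ψ ⬝ᵥ (envBlock U a b *ᵥ ψ), ?_⟩
  have horth (φ : m → ℂ) (hφ : star ψ ⬝ᵥ φ = 0) : star φ ⬝ᵥ (envBlock U a b *ᵥ ψ) = 0 := by
    have h := partialTraceEnv_evolve_apply U ψ φ σE
    rw [← hU.dilates _ (isDensityMatrix_vecMulVec h1), dephasing_vecMulVec hQ hψ,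
      Matrix.vecMulVec_mulVec, hφ] at h
    exact eq_zero_of_sum_dotProduct hσE (h.symm.trans (by simp)) a b
  set v := envBlock U a b *ᵥ ψ
  have h2 : star ψ ⬝ᵥ (v - (star ψ ⬝ᵥ v) • ψ) = 0 := by
    rw [dotProduct_sub, dotProduct_smul, h1]
    simp
  have h3 : star (v - (star ψ ⬝ᵥ v) • ψ) ⬝ᵥ ψ = 0 := by
    have := congrArg star h2
    rwa [Matrix.star_dotProduct, star_star, star_zero] at this
  have h4 : star (v - (star ψ ⬝ᵥ v) • ψ) ⬝ᵥ (v - (star ψ ⬝ᵥ v) • ψ) = 0 := by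
    rw [dotProduct_sub, horth _ h2, dotProduct_smul, h3]
    simp
  exact sub_eq_zero.1 (dotProduct_star_self_eq_zero.1 h4)

/-- If every vector of a subspace is an eigenvector, the eigenvalues agree: compare x, y and x + y.
-/
theorem exists_eigenvalue_of_forall_mem {P A : Matrix m m ℂ} (hP : P * P = P)
    (h : ∀ ψ : m → ℂ, P *ᵥ ψ = ψ → ∃ c : ℂ, A *ᵥ ψ = c • ψ) : ∃ c : ℂ, A * P = c • P := by
  by_cases hP0 : P = 0
  · exact ⟨0, by simp [hP0]⟩
  have hPv (x : m → ℂ) : P *ᵥ (P *ᵥ x) = P *ᵥ x := by rw [Matrix.mulVec_mulVec, hP]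
  obtain ⟨x, hx⟩ : ∃ x, P *ᵥ x ≠ 0 := by
    by_contra! hall
    exact hP0 (Matrix.mulVec_injective <| funext fun x => by simpa using hall x)
  obtain ⟨c, hc⟩ := h _ (hPv x)
  refine ⟨c, Matrix.mulVec_injective <| funext fun y => ?_⟩
  change (A * P) *ᵥ y = (c • P) *ᵥ y
  rw [← Matrix.mulVec_mulVec, Matrix.smul_mulVec]
  obtain ⟨c', hc'⟩ := h _ (hPv y)
  obtain ⟨c'', hc''⟩ := h (P *ᵥ x + P *ᵥ y) (by rw [Matrix.mulVec_add, hPv, hPv])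
  rw [Matrix.mulVec_add, hc, hc', smul_add] at hc''
  by_cases hcc : c'' = c'
  · subst hcc
    have h1 : c • (P *ᵥ x) = c'' • (P *ᵥ x) := add_right_cancel hc''
    rw [hc', smul_left_injective ℂ hx h1]
  · have h1 : (c'' - c') • (P *ᵥ y) = (c - c'') • (P *ᵥ x) := by
      rw [sub_smul, sub_smul, sub_eq_sub_iff_add_eq_add, add_comm, ← hc'', add_comm]
    have h2 : P *ᵥ y = ((c'' - c')⁻¹ * (c - c'')) • (P *ᵥ x) := by
      rw [mul_smul, ← h1, inv_smul_smul₀ (sub_ne_zero.2 hcc)]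
    rw [h2, Matrix.mulVec_smul, hc, smul_comm]

/-- Every dilation of the dephasing map with a faithful environment state is controlled by the
blocks. -/
theorem IsDephasingDilation.exists_controlledUnitary {Q : κ → Matrix m m ℂ}
    (hQ : IsProjectiveDecomposition Q) {σE : Matrix e e ℂ} (hσE : σE.PosDef)
    {U : Matrix (m × e) (m × e) ℂ} (hU : IsDephasingDilation Q σE U) :
    ∃ V : κ → Matrix e e ℂ, (∀ k, V k ∈ Matrix.unitaryGroup e ℂ) ∧
      U = controlledUnitary Q V := by
  classical
  choose v hv using fun (k : κ) (a b : e) => exists_eigenvalue_of_forall_mem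
    (A := envBlock U a b) (hQ.idempotent k) fun ψ hψ => hU.exists_eigenvalue hQ hσE hψ a b
  -- On a zero block `v k` is arbitrary, so the value 1 is imposed to keep V_k unitary.
  set V : κ → Matrix e e ℂ := fun k => if Q k = 0 then 1 else Matrix.of (v k) with hV
  have hQV (k : κ) (a b : e) : envBlock U a b * Q k = V k a b • Q k := by
    by_cases h : Q k = 0
    · simp [h]
    · simp [hV, h, hv]
  have hUV : U = controlledUnitary Q V := by
    ext ⟨i, a⟩ ⟨j, b⟩
    have h : envBlock U a b = ∑ k, V k a b • Q k := by
      rw [← Matrix.mul_one (envBlock U a b), ← hQ.sum_eq_one, Finset.mul_sum]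
      exact Finset.sum_congr rfl fun k _ => hQV k a b
    have h2 := congrFun₂ h i j
    simp only [envBlock, Matrix.of_apply, Matrix.sum_apply, Matrix.smul_apply,
      smul_eq_mul] at h2
    rw [h2, controlledUnitary, Matrix.sum_apply]
    exact Finset.sum_congr rfl fun k _ => mul_comm _ _
  refine ⟨V, fun k => ?_, hUV⟩
  by_cases hk : Q k = 0
  · simp only [hV, hk, if_true]
    exact one_mem _
  rw [Matrix.mem_unitaryGroup_iff, Matrix.star_eq_conjTranspose]
  have h1 : evolve U (Q k) (1 : Matrix e e ℂ) = Q k ⊗ₖ (V k * (V k)ᴴ) := by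
    rw [hUV, evolve_controlledUnitary hQ.isHermitian, Finset.sum_eq_single k]
    · rw [Finset.sum_eq_single k]
      · rw [hQ.idempotent, hQ.idempotent, Matrix.mul_one]
      · intro j _ hj
        rw [hQ.idempotent, hQ.mul_eq_zero hj.symm, Matrix.zero_kronecker]
      · simp
    · intro i _ hi
      refine Finset.sum_eq_zero fun j _ => ?_
      rw [hQ.mul_eq_zero hi, Matrix.zero_mul, Matrix.zero_kronecker]
    · simp
  -- Since U commutes with Q_k ⊗ 1, unitarity gives Q_k ⊗ V_k V_k† = Q_k ⊗ 1; a nonzero entry of Q_k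
  -- then cancels.
  have h2 : U * (Q k ⊗ₖ (1 : Matrix e e ℂ)) = (Q k ⊗ₖ (1 : Matrix e e ℂ)) * U := by
    rw [hUV, controlledUnitary, Finset.sum_mul, Finset.mul_sum]
    refine Finset.sum_congr rfl fun j _ => ?_
    rw [← Matrix.mul_kronecker_mul, ← Matrix.mul_kronecker_mul, Matrix.mul_one, Matrix.one_mul,
      hQ.mul_eq_ite, hQ.mul_eq_ite]
    by_cases h : j = k
    · simp [h]
    · simp [h, Ne.symm h]
  rw [evolve, h2, Matrix.mul_assoc, ← Matrix.star_eq_conjTranspose U,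
    Matrix.mem_unitaryGroup_iff.1 hU.unitary, Matrix.mul_one] at h1
  obtain ⟨i, j, hij⟩ : ∃ i j, Q k i j ≠ 0 := by
    by_contra! hall
    exact hk (Matrix.ext hall)
  ext a b
  have h3 := congrFun₂ h1 (i, a) (j, b)
  simp only [Matrix.kroneckerMap_apply] at h3
  exact (mul_left_cancel₀ hij h3).symm

theorem energyCost_nonneg {Q : κ → Matrix m m ℂ} (hQ : IsProjectiveDecomposition Q)
    {H : κ → Matrix m m ℂ} (hH : ∀ k, IsHamiltonianOn (Q k) (H k)) {HE : Matrix e e ℂ}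
    (hHE : HE.IsHermitian) {β : ℝ} (hβ : 0 ≤ β) {U : Matrix (m × e) (m × e) ℂ}
    (hU : IsDephasingDilation Q (thermalState β HE) U) {σ : Matrix m m ℂ}
    (hσ : IsDensityMatrix σ) :
    0 ≤ energyCost (∑ k, H k) HE U σ (thermalState β HE) := by
  cases isEmpty_or_nonempty e
  · simp [energyCost, Matrix.trace]
  obtain ⟨V, hV, rfl⟩ := hU.exists_controlledUnitary hQ (thermalState_posDef hHE β)
  rw [energyCost_eq_environment hQ hH HE (thermalState_trace hHE β) hU hσ,
    environmentEnergy_controlledUnitary hQ, sub_nonneg]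
  calc (HE * thermalState β HE).trace
      = ∑ k, (Q k * σ).trace * (HE * thermalState β HE).trace := by
        rw [← Finset.sum_mul, hQ.sum_trace_mul, hσ.trace_eq_one, one_mul]
    _ ≤ _ := Finset.sum_le_sum fun k _ => mul_le_mul_of_nonneg_left
        (thermalState_passive hHE hβ (hV k)) (hQ.trace_mul_nonneg hσ.posSemidef k)

end Structure

theorem mainTheorem7 {m κ : Type*} [Fintype m] [DecidableEq m] [Fintype κ] [DecidableEq κ]
    (Q : κ → Matrix m m ℂ) (hQ : IsProjectiveDecomposition Q)
    (H : κ → Matrix m m ℂ) (hH : ∀ k, IsHamiltonianOn (Q k) (H k)) :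
    -- every dilation with a thermal environment has non-negative energy cost
    (∀ (e : Type*) [Fintype e] [DecidableEq e] (HE : Matrix e e ℂ), HE.IsHermitian →
      ∀ β : ℝ, 0 ≤ β → ∀ U : Matrix (m × e) (m × e) ℂ,
        IsDephasingDilation Q (thermalState β HE) U →
        ∀ σ : Matrix m m ℂ, IsDensityMatrix σ →
          0 ≤ energyCost (∑ k, H k) HE U σ (thermalState β HE)) ∧
    -- the value zero is attained
    (∀ β : ℝ, ∃ (d : ℕ) (HE : Matrix (Fin d) (Fin d) ℂ)
      (U : Matrix (m × Fin d) (m × Fin d) ℂ), 0 < d ∧ HE.IsHermitian ∧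
        IsDephasingDilation Q (thermalState β HE) U ∧
        ∀ σ : Matrix m m ℂ, IsDensityMatrix σ →
          energyCost (∑ k, H k) HE U σ (thermalState β HE) = 0) ∧
    -- with trivial environment Hamiltonian, trace-orthogonal unitaries give cost zero
    (∀ (e : Type*) [Fintype e] [DecidableEq e] [Nonempty e] (V : κ → Matrix e e ℂ),
      (∀ k, V k ∈ Matrix.unitaryGroup e ℂ) →
      (∀ i j, (V i * (V j)ᴴ).trace = if i = j then (Fintype.card e : ℂ) else 0) →
      ∀ β : ℝ, thermalState β (0 : Matrix e e ℂ) = (Fintype.card e : ℂ)⁻¹ • 1 ∧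
        IsDephasingDilation Q (thermalState β (0 : Matrix e e ℂ)) (controlledUnitary Q V) ∧
        ∀ σ : Matrix m m ℂ, IsDensityMatrix σ →
          energyCost (∑ k, H k) 0 (controlledUnitary Q V) σ
            (thermalState β (0 : Matrix e e ℂ)) = 0) ∧
    -- the Weyl operators are trace-orthogonal unitaries
    (∀ (d : ℕ) (l t : Fin d), weylOperator d l t ∈ Matrix.unitaryGroup (Fin d) ℂ ∧
      ∀ l' t' : Fin d, (weylOperator d l t * (weylOperator d l' t')ᴴ).trace =
        if l = l' ∧ t = t' then (d : ℂ) else 0) ∧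
    -- hence distinct Weyl operators give a dilation of cost zero
    (∀ d : ℕ, 0 < d → ∀ f : κ → Fin d × Fin d, Function.Injective f → ∀ β : ℝ,
      IsDephasingDilation Q (thermalState β (0 : Matrix (Fin d) (Fin d) ℂ))
        (controlledUnitary Q fun k => weylOperator d (f k).1 (f k).2) ∧
      ∀ σ : Matrix m m ℂ, IsDensityMatrix σ →
        energyCost (∑ k, H k) 0 (controlledUnitary Q fun k => weylOperator d (f k).1 (f k).2) σ
          (thermalState β (0 : Matrix (Fin d) (Fin d) ℂ)) = 0) := by
  have weyl : ∀ d : ℕ, 0 < d → ∀ f : κ → Fin d × Fin d, Function.Injective f → ∀ β : ℝ,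
      IsDephasingDilation Q (thermalState β (0 : Matrix (Fin d) (Fin d) ℂ))
        (controlledUnitary Q fun k => weylOperator d (f k).1 (f k).2) := by
    intro d hd f hf β
    have : Nonempty (Fin d) := ⟨⟨0, hd⟩⟩
    refine isDephasingDilation_of_trace_orthogonal hQ
      (fun k => weylOperator_mem_unitaryGroup d _ _) (fun i j => ?_) β
    simp only [trace_weylOperator_mul, ← Prod.ext_iff, hf.eq_iff, Fintype.card_fin]
  refine ⟨?_, ?_, ?_, ?_, ?_⟩
  · intro e _ _ HE hHE β hβ U hU σ hσ
    exact energyCost_nonneg hQ hH hHE hβ hU hσ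
  · intro β
    -- Shifts alone (t = 0) separate the blocks; dimension K + 1 stays positive even when `κ` is
    -- empty.
    have hf : Function.Injective fun k : κ =>
        (((Fintype.equivFin κ k).castSucc, 0) :
          Fin (Fintype.card κ + 1) × Fin (Fintype.card κ + 1)) := by
      intro i j h
      simpa using h
    have hU := weyl _ (Nat.succ_pos _) _ hf β
    exact ⟨_, 0, _, Nat.succ_pos _, Matrix.isHermitian_zero, hU,
      fun σ hσ => energyCost_zero_hamiltonian hQ hH hU hσ⟩
  · intro e _ _ _ V hV hVV β
    have hU := isDephasingDilation_of_trace_orthogonal hQ hV hVV β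
    exact ⟨thermalState_zero β, hU, fun σ hσ => energyCost_zero_hamiltonian hQ hH hU hσ⟩
  · exact fun d l t => ⟨weylOperator_mem_unitaryGroup d l t, trace_weylOperator_mul d l t⟩
  · intro d hd f hf β
    have : Nonempty (Fin d) := ⟨⟨0, hd⟩⟩
    have hU := weyl d hd f hf β
    exact ⟨hU, fun σ hσ => energyCost_zero_hamiltonian hQ hH hU hσ⟩
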